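/- **Proposition 2.1.** Let $P$ be a finite poset, let $P^{op}$ be the opposite poset, and let $\mathcal I(P)$ be the set of order ideals (down-closed subsets) of $P$. Let $\mathbb C[P]\subseteq\mathbb C[x_p\,(p\in P),t]$ be the Hibi ring, i.e. the $\mathbb C$-subalgebra generated by the monomials $t\prod_{p\in I}x_p$, $I\in\mathcal I(P)$, graded so that these generators have degree $1$ (the grading induced by the standard grading of $\mathbb C[y_I: I\in\mathcal I(P)]$ under the surjection $y_I\mapsto t\prod_{p\in I}x_p$), and let $X_P=\operatorname{Proj}\mathbb C[P]$ be the Hibi variety. For $S\subseteq P$ let $\mathbf a_S\in\{0,1\}^P$ be its characteristic vector. Let $\mathcal O(P^{op})\subseteq\mathbb R^P$ be the order polytope of $P^{op}$, i.e. the convex hull of the vectors $\mathbf a_J$, where $J$ runs over the order filters (up-closed subsets) of $P^{op}$. For a finite set $\mathcal A\subseteq\mathbb Z^P$, let $X_{\mathcal A}\subseteq\mathbb P^{|\mathcal A|-1}$ be the Zariski closure, with its reduced structure, of the set of the points $[t^a]_{a\in\mathcal A}$, $t\in(\mathbb C^*)^P$. A lattice polytope $Q\subseteq\mathbb R^P$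 is *very ample* if for every vertex $m$ of $Q$ the semigroup generated by $\{z-m: z\in Q\cap\mathbb Z^P\}$ is saturated in $\mathbb Z^P$. The projective toric variety of a full-dimensional lattice polytope $Q$ is $X_{kQ\cap\mathbb Z^P}$, where $k\ge1$ is such that $kQ$ is very ample (up to isomorphism it does not depend on $k$; to fix it, let $k$ be least). Then: 1. $X_P$ is isomorphic, as a scheme over $\mathbb C$, to the projective toric variety of the order polytope $\mathcal O(P^{op})$. 2. The lattice points of $\mathcal O(P^{op})$ are exactly the characteristic vectors of the order ideals of $P$: $\mathcal O(P^{op})\cap\mathbb Z^P=\{\mathbf a_I: I\in\mathcal I(P)\}$. 3. $\mathcal O(P^{op})$ has a unimodular triangulation: it is the union of a finite simplicial complex whose simplices have vertices in $\mathbb Z^P$ and are unimodular (the edge vectors $w-v$ at each vertex $v$ of a simplex generate the group of all vectors of $\mathbb Z^P$ in their real linear span). 4. $\mathcal O(P^{op})$ is normal: $(kQ\cap\mathbb Z^P)+(lQ\cap\mathbb Z^P)=(k+l)Q\cap\mathbb Z^P$ for $Q=\mathcal O(P^{op})$ and all integers $k,l\ge0$. -/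

import Mathlib

namespace HibiVariety

open MvPolynomial CategoryTheory AlgebraicGeometry
open scoped Pointwise

noncomputable section

/-! ### Projective schemes over the complex numbers -/

/-- `Proj` of an `ℕ`-graded `ℂ`-algebra, together with its structure morphism to `Spec ℂ`. -/
def projOverC {A : Type} [CommRing A] [Algebra ℂ A] (𝒜 : ℕ → Submodule ℂ A) [GradedAlgebra 𝒜] :
    Over (Spec (CommRingCat.of ℂ)) :=
  Over.mk (Proj.toSpecZero 𝒜 ≫ Spec.map (CommRingCat.ofHom (algebraMap ℂ (𝒜 0))))

/-! ### The Hibi ring and the Hibi variety -/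

section Hibi

variable (P : Type) [Fintype P] [PartialOrder P]

open Classical in
/-- The monomial `t ∏_{p ∈ I} x_p` of an order ideal `I`, in the polynomial ring with variables
`x_p = X (some p)` and `t = X none`. -/
def hibiMonomial (I : LowerSet P) : MvPolynomial (Option P) ℂ :=
  X none * ∏ p with p ∈ I, X (some p)

/-- The Hibi ring `ℂ[P]`. -/
def hibiRing : Subalgebra ℂ (MvPolynomial (Option P) ℂ) :=
  Algebra.adjoin ℂ (Set.range (hibiMonomial P))

/-- The surjection `ℂ[y_I] → ℂ[P]` that sends `y_I` to `t ∏_{p ∈ I} x_p`. -/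
def hibiPresentation : MvPolynomial (LowerSet P) ℂ →ₐ[ℂ] hibiRing P :=
  aeval fun I => ⟨hibiMonomial P I, Algebra.subset_adjoin ⟨I, rfl⟩⟩

/-- The grading of the Hibi ring that is induced by the standard grading of `ℂ[y_I]`. -/
def hibiGrading (d : ℕ) : Submodule ℂ (hibiRing P) :=
  (homogeneousSubmodule (LowerSet P) ℂ d).map (hibiPresentation P).toLinearMap

theorem hibiPresentation_surjective : Function.Surjective (hibiPresentation P) := by
  have h : ((hibiRing P).val.comp (hibiPresentation P)).range = hibiRing P := by
    have e : (hibiRing P).val.comp (hibiPresentation P) = aeval (hibiMonomial P) := by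
      ext I
      simp [hibiPresentation]
    rw [e, hibiRing, Algebra.adjoin_range_eq_range_aeval]
  rintro ⟨x, hx⟩
  rw [← h] at hx
  obtain ⟨y, hy⟩ := hx
  exact ⟨y, Subtype.ext hy⟩

/-- The degree in `t`: the variable `t` has weight one, the variables `x_p` have weight zero. -/
def tWeight : Option P → ℕ
  | none => 1
  | some _ => 0

theorem hibiMonomial_isWeightedHomogeneous (I : LowerSet P) :
    IsWeightedHomogeneous (tWeight P) (hibiMonomial P I) 1 := by
  classical
  have h := IsWeightedHomogeneous.prod (w := tWeight P) (R := ℂ)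
    (Finset.univ.filter (fun p => p ∈ I)) (fun p => X (some p)) (fun _ => 0)
    (fun p _ => isWeightedHomogeneous_X ℂ (tWeight P) (some p))
  have h2 := (isWeightedHomogeneous_X ℂ (tWeight P) none).mul h
  simpa [hibiMonomial, tWeight] using h2

theorem hibiGrading_isWeightedHomogeneous {d : ℕ} {a : hibiRing P} (ha : a ∈ hibiGrading P d) :
    IsWeightedHomogeneous (tWeight P) (a : MvPolynomial (Option P) ℂ) d := by
  obtain ⟨f, hf, rfl⟩ := ha
  have hf' : f.IsHomogeneous d := hf
  have e : ((hibiPresentation P f : hibiRing P) : MvPolynomial (Option P) ℂ) =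
      aeval (hibiMonomial P) f := by
    have : (hibiRing P).val.comp (hibiPresentation P) = aeval (hibiMonomial P) := by
      ext I
      simp [hibiPresentation]
    exact DFunLike.congr_fun this f
  change IsWeightedHomogeneous (tWeight P)
    ((hibiPresentation P f : hibiRing P) : MvPolynomial (Option P) ℂ) d
  rw [e, aeval_def, eval₂_eq]
  refine IsWeightedHomogeneous.sum _ _ _ fun m hm => ?_
  refine IsWeightedHomogeneous.C_mul ?_ _
  have h := IsWeightedHomogeneous.prod (w := tWeight P) (R := ℂ) m.support
    (fun I => hibiMonomial P I ^ m I) (fun I => m I • 1)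
    (fun I _ => (hibiMonomial_isWeightedHomogeneous P I).pow _)
  have hd : ∑ I ∈ m.support, m I • 1 = d := by
    have := hf' (mem_support_iff.mp hm)
    rw [← this, Finsupp.weight_apply, Finsupp.sum]
    simp
  rwa [hd] at h

theorem hibiGrading_isInternal : DirectSum.IsInternal (hibiGrading P) := by
  rw [DirectSum.isInternal_submodule_iff_iSupIndep_and_iSup_eq_top]
  constructor
  · rw [iSupIndep_iff_finsetSum_eq_zero_imp_eq_zero]
    intro s v hmem hv i hi
    have h0 : ∑ j ∈ s, ((v j : hibiRing P) : MvPolynomial (Option P) ℂ) = 0 := by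
      have := congrArg (fun z : hibiRing P => (z : MvPolynomial (Option P) ℂ)) hv
      simpa using this
    have h1 := congrArg (weightedHomogeneousComponent (tWeight P) i) h0
    rw [map_sum, map_zero, Finset.sum_eq_single_of_mem i hi] at h1
    · rw [(hibiGrading_isWeightedHomogeneous P (hmem i hi)).weightedHomogeneousComponent_same]
        at h1
      exact Subtype.ext h1
    · intro j hj hji
      exact (hibiGrading_isWeightedHomogeneous P (hmem j hj)).weightedHomogeneousComponent_ne i hji.symm
  · rw [eq_top_iff]
    rintro a -
    obtain ⟨f, rfl⟩ := hibiPresentation_surjective P a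
    rw [← sum_homogeneousComponent f, map_sum]
    refine Submodule.sum_mem _ fun i _ => ?_
    exact Submodule.mem_iSup_of_mem i ⟨_, homogeneousComponent_mem _ _, rfl⟩

instance hibiGradedAlgebra : GradedAlgebra (hibiGrading P) where
  one_mem := ⟨1, isHomogeneous_one _ _, map_one (hibiPresentation P)⟩
  mul_mem := by
    rintro i j _ _ ⟨f, hf, rfl⟩ ⟨g, hg, rfl⟩
    exact ⟨f * g, IsHomogeneous.mul hf hg, map_mul (hibiPresentation P) _ _⟩
  toDecomposition := (hibiGrading_isInternal P).chooseDecomposition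

/-- The projective Hibi variety `X_P = Proj ℂ[P]`, as a scheme over `ℂ`. -/
def hibiVariety : Over (Spec (CommRingCat.of ℂ)) :=
  projOverC (hibiGrading P)

end Hibi

/-! ### Lattice polytopes -/

section Polytopes

variable {ι : Type}

/-- The inclusion of the lattice `ℤ^ι` into `ℝ^ι`. -/
def latticeEmb (z : ι → ℤ) : ι → ℝ := fun i => z i

/-- The lattice points `Q ∩ ℤ^ι` of a subset `Q` of `ℝ^ι`. -/
def latticePoints (Q : Set (ι → ℝ)) : Set (ι → ℤ) :=
  {z | latticeEmb z ∈ Q}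

/-- `Q` is normal: `(kQ ∩ M) + (lQ ∩ M) = (k + l)Q ∩ M` for all natural numbers `k`, `l`. -/
def IsNormal (Q : Set (ι → ℝ)) : Prop :=
  ∀ k l : ℕ, latticePoints ((k : ℝ) • Q) + latticePoints ((l : ℝ) • Q) =
    latticePoints (((k + l : ℕ) : ℝ) • Q)

/-- `Q` is very ample: for every vertex `m` of `Q`, the semigroup generated by the differences
`z - m`, where `z` is a lattice point of `Q`, is saturated in the lattice. -/
def IsVeryAmple (Q : Set (ι → ℝ)) : Prop :=
  ∀ m : ι → ℤ, latticeEmb m ∈ Q.extremePoints ℝ →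
    ∀ (n : ℕ) (z : ι → ℤ), 0 < n →
      n • z ∈ AddSubmonoid.closure ((fun w => w - m) '' latticePoints Q) →
      z ∈ AddSubmonoid.closure ((fun w => w - m) '' latticePoints Q)

/-- `Q` has a unimodular triangulation: it is the union of a finite simplicial complex whose
simplices have lattice points as vertices and are unimodular, which means that the edge vectors
at a vertex generate the group of all lattice points in the linear space that they span. -/
def HasUnimodularTriangulation (Q : Set (ι → ℝ)) : Prop :=
  ∃ K : Geometry.SimplicialComplex ℝ (ι → ℝ), K.faces.Finite ∧ K.space = Q ∧
    ∀ s ∈ K.faces, (∀ v ∈ s, v ∈ Set.range (latticeEmb (ι := ι))) ∧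
      ∀ v ∈ s, ∀ z : ι → ℤ,
        latticeEmb z ∈ Submodule.span ℝ ((fun w => w - v) '' (s : Set (ι → ℝ))) →
        latticeEmb z ∈ Submodule.span ℤ ((fun w => w - v) '' (s : Set (ι → ℝ)))

/-- The order polytope of a poset: the convex hull of the characteristic vectors of its order
filters. -/
def orderPolytope (P : Type) [PartialOrder P] : Set (P → ℝ) :=
  convexHull ℝ (Set.range fun J : UpperSet P => Set.indicator (J : Set P) (1 : P → ℝ))

end Polytopes

/-! ### Projective toric varieties -/

section Toric

attribute [local instance] MvPolynomial.gradedAlgebra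

/-- Projective space over `ℂ` with homogeneous coordinates indexed by `σ`. -/
def projectiveSpace (σ : Type) : Over (Spec (CommRingCat.of ℂ)) :=
  projOverC (homogeneousSubmodule σ ℂ)

variable {σ : Type}

/-- Restriction of a polynomial to the line `ℂ v`, as a polynomial in the parameter of the line. -/
def restrictToLine (v : σ → ℂ) : MvPolynomial σ ℂ →ₐ[ℂ] Polynomial ℂ :=
  aeval fun a => Polynomial.C (v a) * Polynomial.X

theorem restrictToLine_of_isHomogeneous (v : σ → ℂ) {f : MvPolynomial σ ℂ} {d : ℕ}
    (hf : f.IsHomogeneous d) :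
    restrictToLine v f = Polynomial.C (eval v f) * Polynomial.X ^ d := by
  rw [restrictToLine, aeval_def, eval₂_eq, eval_eq, map_sum, Finset.sum_mul]
  refine Finset.sum_congr rfl fun m hm => ?_
  have hd : ∑ a ∈ m.support, m a = d := by
    have := hf (mem_support_iff.mp hm)
    rw [← this, Finsupp.weight_apply, Finsupp.sum]
    simp
  simp only [mul_pow, Finset.prod_mul_distrib, Finset.prod_pow_eq_pow_sum, hd, map_mul, map_prod,
    map_pow, Polynomial.algebraMap_eq]
  ring

/-- The prime ideal of the line `ℂ v`: all polynomials that vanish on it. -/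
def lineIdeal (v : σ → ℂ) : HomogeneousIdeal (homogeneousSubmodule σ ℂ) where
  toSubmodule := RingHom.ker (restrictToLine v)
  is_homogeneous' := by
    intro i f hf
    have hf' : restrictToLine v f = 0 := hf
    have hi := MvPolynomial.decomposition.decompose'_apply f i
    change restrictToLine v (decomposition.decompose' f i : MvPolynomial σ ℂ) = 0
    rw [hi]
    rw [restrictToLine_of_isHomogeneous v (homogeneousComponent_isHomogeneous i f)]
    rw [← sum_homogeneousComponent f, map_sum] at hf'
    have h := congrArg (fun q => Polynomial.coeff q i) hf'
    simp only [restrictToLine_of_isHomogeneous v (homogeneousComponent_isHomogeneous _ f),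
      Polynomial.finsetSum_coeff, Polynomial.coeff_C_mul_X_pow, Polynomial.coeff_zero,
      Finset.sum_ite_eq] at h
    split_ifs at h with hi
    · rw [h]; simp
    · rw [homogeneousComponent_eq_zero i f (by simpa using hi)]; simp

theorem mem_lineIdeal (v : σ → ℂ) (f : MvPolynomial σ ℂ) :
    f ∈ lineIdeal v ↔ ∀ c : ℂ, eval (c • v) f = 0 := by
  have key : ∀ c : ℂ, (restrictToLine v f).eval c = eval (c • v) f := by
    intro c
    have : ((Polynomial.aeval c).comp (restrictToLine v)) = aeval (c • v) := by
      ext a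
      rw [AlgHom.comp_apply, restrictToLine, aeval_X, aeval_X]
      rw [map_mul, Polynomial.aeval_C, Polynomial.aeval_X]
      exact mul_comm _ _
    have h := DFunLike.congr_fun this f
    rw [AlgHom.comp_apply, Polynomial.coe_aeval_eq_eval, ← coe_aeval_eq_eval] at *
    exact h
  change restrictToLine v f = 0 ↔ _
  constructor
  · intro h c
    rw [← key, h, Polynomial.eval_zero]
  · intro h
    refine Polynomial.funext fun c => ?_
    rw [key, h, Polynomial.eval_zero]

/-- The point of projective space with homogeneous coordinates `v`. -/
def projPoint (v : σ → ℂ) (hv : v ≠ 0) : Proj (homogeneousSubmodule σ ℂ) where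
  asHomogeneousIdeal := lineIdeal v
  isPrime := RingHom.ker_isPrime _
  not_irrelevant_le := by
    intro h
    refine hv (funext fun a => ?_)
    have hX : (X a : MvPolynomial σ ℂ) ∈ HomogeneousIdeal.irrelevant (homogeneousSubmodule σ ℂ) := by
      rw [HomogeneousIdeal.mem_irrelevant_iff, GradedRing.proj_apply]
      change ((decomposition.decompose' (X a : MvPolynomial σ ℂ) 0 :
        homogeneousSubmodule σ ℂ 0) : MvPolynomial σ ℂ) = 0
      rw [MvPolynomial.decomposition.decompose'_apply]
      simp [homogeneousComponent_zero]
    simpa using (mem_lineIdeal v (X a)).1 (h hX) 1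

variable {ι : Type} [Fintype ι]

/-- The monomial map `Φ_𝒜 : (ℂˣ)^ι → ℂ^𝒜`, `t ↦ (t^a)_{a ∈ 𝒜}`. -/
def monomialMap (𝒜 : Set (ι → ℤ)) (t : ι → ℂˣ) : 𝒜 → ℂ :=
  fun a => ((∏ i, t i ^ (a : ι → ℤ) i : ℂˣ) : ℂ)

/-- The set of the points of projective space of the form `[Φ_𝒜(t)]` with `t` in the torus. -/
def torusImage (𝒜 : Set (ι → ℤ)) : Set (Proj (homogeneousSubmodule 𝒜 ℂ)) :=
  {x | ∃ (t : ι → ℂˣ) (h : monomialMap 𝒜 t ≠ 0), x = projPoint (monomialMap 𝒜 t) h}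

/-- The projective toric variety `X_𝒜` of a finite set `𝒜` of lattice points: the Zariski closure
in projective space of the image of the torus under `t ↦ [Φ_𝒜(t)]`, with its reduced structure. -/
def toricVariety (𝒜 : Set (ι → ℤ)) : Over (Spec (CommRingCat.of ℂ)) :=
  Over.mk ((Scheme.IdealSheafData.vanishingIdeal (X := Proj (homogeneousSubmodule 𝒜 ℂ))
    ⟨closure (torusImage 𝒜), isClosed_closure⟩).subschemeι ≫ (projectiveSpace 𝒜).hom)

/-- The least positive integer `k` such that `kQ` is very ample. -/
def veryAmpleMultiple (Q : Set (ι → ℝ)) : ℕ :=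
  sInf {k : ℕ | 0 < k ∧ IsVeryAmple ((k : ℝ) • Q)}

/-- The projective toric variety of a full-dimensional lattice polytope `Q`: it is `X_𝒜` for the
set `𝒜` of the lattice points of a very ample multiple `kQ` with `k ≥ 1`. Up to isomorphism it does
not depend on `k`; here `k` is the least possible. -/
def polytopeToricVariety (Q : Set (ι → ℝ)) : Over (Spec (CommRingCat.of ℂ)) :=
  toricVariety (latticePoints ((veryAmpleMultiple Q : ℝ) • Q))

end Toric

end

end HibiVariety

/-!
Write `Q` for the order polytope of a finite poset `R`; the theorem concerns `R = Pᵒᵈ`, whose order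
filters are the order ideals of `P`.

**Polytope.** The layer cake decomposition (`exists_chainWeights`) writes a monotone function with
values in `[0, c]` as a combination of the characteristic vectors of a *chain* of filters, with
nonnegative weights of total `c`. Hence `kQ` is the set of the monotone functions with values in
`[0, k]` (`mem_smul_orderPolytope_iff`), which gives the lattice points of `Q`, and also normality,
as `z = min z k + (z - min z k)`. Normality makes `Q` itself very ample.

**Triangulation.** The simplices are the convex hulls of the chains of filters. For weights on a
chain, the total weight of the filters that contain a given nonempty filter `T` is a coordinate of
the weighted sum of the characteristic vectors (`sum_le_eq_total_or_apply`), and Möbius inversion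
over `T` recovers the weights. This one observation shows that the simplices are affinely
independent, that they meet along common faces (`chainWeight_unique`), and that they are unimodular
(`chainWeight_mem`, for the subgroup `ℤ` of `ℝ`).

**Toric variety.** Since `Q` is very ample, its toric variety is the closure of the torus orbit
`[u^a]`, where `a` runs over the lattice points of `Q`, that is, over the order ideals of `P`. A
surjection of graded rings induces a closed immersion of `Proj` onto the zero locus of the kernel
(`isClosedImmersion_projMap`, `range_projMap`). For the presentation of the Hibi ring, the kernel
is the ideal of all polynomials that vanish on the torus orbit (`latticePresentation_eq_zero_iff`),
so that the image is the closure of the orbit. As the Hibi ring is a domain, its `Proj` is reduced,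
and a reduced closed subscheme is determined by its underlying set
(`exists_iso_subscheme_vanishingIdeal`).
-/

namespace HibiVariety

open MvPolynomial CategoryTheory AlgebraicGeometry
open scoped Pointwise

noncomputable section

/-! ### Weights on chains of order filters -/

section ChainWeights

variable {R : Type} [PartialOrder R]

/-- The characteristic vector of an order filter. -/
def filterVec (J : UpperSet R) : R → ℝ :=
  Set.indicator (J : Set R) 1

theorem filterVec_of_mem {J : UpperSet R} {p : R} (hp : p ∈ J) : filterVec J p = 1 :=
  Set.indicator_of_mem (s := (J : Set R)) hp 1

theorem filterVec_of_notMem {J : UpperSet R} {p : R} (hp : p ∉ J) : filterVec J p = 0 :=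
  Set.indicator_of_notMem (s := (J : Set R)) hp 1

theorem filterVec_injective : Function.Injective (filterVec (R := R)) := by
  intro J K h
  refine SetLike.ext fun p => ?_
  have hp := congrFun h p
  by_cases hJ : p ∈ J <;> by_cases hK : p ∈ K <;>
    simp_all [filterVec_of_mem, filterVec_of_notMem]

theorem filterVec_mem_range_latticeEmb (J : UpperSet R) :
    filterVec J ∈ Set.range (latticeEmb (ι := R)) := by
  refine ⟨Set.indicator (J : Set R) 1, funext fun p => ?_⟩
  by_cases hp : p ∈ (J : Set R) <;> simp [latticeEmb, filterVec, hp]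

variable [Fintype R]

/-- The linear combination of the characteristic vectors of all order filters with given
coefficients. -/
def filterComb (w : UpperSet R → ℝ) : R → ℝ :=
  ∑ J, w J • filterVec J

open Classical in
theorem filterComb_apply (w : UpperSet R → ℝ) (p : R) :
    filterComb w p = ∑ J with p ∈ J, w J := by
  rw [filterComb, Finset.sum_apply, Finset.sum_filter]
  refine Finset.sum_congr rfl fun J _ => ?_
  by_cases hp : p ∈ J <;> simp [hp, filterVec_of_mem, filterVec_of_notMem]

open Classical in
theorem filterComb_single (J : UpperSet R) (c : ℝ) :
    filterComb (Pi.single J c) = c • filterVec J := by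
  rw [filterComb, Finset.sum_eq_single J] <;> simp +contextual

theorem filterComb_add (v w : UpperSet R → ℝ) :
    filterComb (v + w) = filterComb v + filterComb w := by
  simp [filterComb, add_smul, Finset.sum_add_distrib]

open Classical in
/-- If the filters that carry the weights `w` form a chain, then the total weight of the filters
that contain `T` is the total of all weights, if `T` is empty, and otherwise it is a coordinate of
the vector `filterComb w`. Indeed, the sets `{J | w J ≠ 0, p ∈ J}` are nested when `p` varies over
`T`, so that one of them is the least. -/
theorem sum_le_eq_total_or_apply (w : UpperSet R → ℝ)
    (hw : IsChain (· ≤ ·) (Function.support w)) (T : UpperSet R) :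
    ∑ J with J ≤ T, w J = ∑ J, w J ∨ ∃ p ∈ T, ∑ J with J ≤ T, w J = filterComb w p := by
  rcases (Finset.univ.filter (· ∈ T)).eq_empty_or_nonempty with hT | hT
  · left
    rw [Finset.filter_true_of_mem]
    intro J _ p hp
    have : p ∈ Finset.univ.filter (· ∈ T) := Finset.mem_filter.2 ⟨Finset.mem_univ p, hp⟩
    simp [hT] at this
  · right
    obtain ⟨p, hpT, hp⟩ := Finset.exists_min_image _
      (fun p : R => (Finset.univ.filter fun J : UpperSet R => w J ≠ 0 ∧ p ∈ J).card) hT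
    have hpT : p ∈ T := by simpa using hpT
    refine ⟨p, hpT, ?_⟩
    rw [filterComb_apply]
    refine Finset.sum_subset_zero_on_sdiff ?_ ?_ fun _ _ => rfl
    · intro J hJ
      simp only [Finset.mem_filter, Finset.mem_univ, true_and] at hJ ⊢
      exact hJ hpT
    · intro J hJ
      simp only [Finset.mem_sdiff, Finset.mem_filter, Finset.mem_univ, true_and] at hJ
      by_contra hJw
      refine hJ.2 fun q hq => ?_
      by_contra hqJ
      have hq' : q ∈ T := hq
      -- If `q ∉ J ∋ p`, then each filter of the chain that contains `q` contains `p`.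
      refine (hp q (by simpa using hq')).not_gt (Finset.card_lt_card ?_)
      rw [Finset.ssubset_iff_of_subset]
      · exact ⟨J, Finset.mem_filter.2 ⟨Finset.mem_univ J, hJw, hJ.1⟩,
          fun h => hqJ (Finset.mem_filter.1 h).2.2⟩
      · intro K hK
        simp only [Finset.mem_filter, Finset.mem_univ, true_and] at hK ⊢
        refine ⟨hK.1, ?_⟩
        rcases hw.total hK.1 (show J ∈ Function.support w from hJw) with h | h
        · exact h hJ.1
        · exact absurd (h hK.2) hqJ

open Classical in
/-- Möbius inversion: a family whose sums over all sets `{J | J ≤ T}` lie in a subgroup lies in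
this subgroup. -/
theorem mem_of_forall_sum_le_mem (G : AddSubgroup ℝ) (d : UpperSet R → ℝ)
    (h : ∀ T, ∑ J with J ≤ T, d J ∈ G) (T : UpperSet R) : d T ∈ G := by
  induction T using WellFoundedLT.induction with
  | ind T ih =>
    have hT : ∑ J with J ≤ T, d J = d T + ∑ J with J < T, d J := by
      have : Finset.univ.filter (· ≤ T) = insert T (Finset.univ.filter (· < T)) := by
        ext J
        simp [le_iff_eq_or_lt]
      rw [this, Finset.sum_insert (by simp)]
    have hlt : ∑ J with J < T, d J ∈ G := G.sum_mem fun J hJ => ih J (by simpa using hJ)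
    have := h T
    rw [hT] at this
    exact (G.add_mem_cancel_right hlt).1 this

theorem chainWeight_mem (G : AddSubgroup ℝ) (w : UpperSet R → ℝ)
    (hw : IsChain (· ≤ ·) (Function.support w)) (hsum : ∑ J, w J ∈ G)
    (hG : ∀ p, filterComb w p ∈ G) (J : UpperSet R) : w J ∈ G := by
  classical
  refine mem_of_forall_sum_le_mem G w (fun T => ?_) J
  rcases sum_le_eq_total_or_apply w hw T with h | ⟨p, -, h⟩
  · rwa [h]
  · rw [h]
    exact hG p

open Classical in
theorem sum_le_of_filterComb_eq {v w : UpperSet R → ℝ}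
    (hv : IsChain (· ≤ ·) (Function.support v)) (hw0 : 0 ≤ w) (hsum : ∑ J, v J = ∑ J, w J)
    (h : filterComb v = filterComb w) (T : UpperSet R) :
    ∑ J with J ≤ T, w J ≤ ∑ J with J ≤ T, v J := by
  rcases sum_le_eq_total_or_apply v hv T with hT | ⟨p, hp, hT⟩
  · rw [hT, hsum]
    exact Finset.sum_le_sum_of_subset_of_nonneg (Finset.filter_subset _ _) fun J _ _ => hw0 J
  · rw [hT, h, filterComb_apply]
    refine Finset.sum_le_sum_of_subset_of_nonneg (fun J hJ => ?_) fun J _ _ => hw0 J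
    simp only [Finset.mem_filter, Finset.mem_univ, true_and] at hJ ⊢
    exact hJ hp

/-- Nonnegative weights on a chain of order filters are determined by their total and by the
corresponding combination of characteristic vectors. The two chains need not be the same. -/
theorem chainWeight_unique {v w : UpperSet R → ℝ}
    (hv : IsChain (· ≤ ·) (Function.support v)) (hw : IsChain (· ≤ ·) (Function.support w))
    (hv0 : 0 ≤ v) (hw0 : 0 ≤ w) (hsum : ∑ J, v J = ∑ J, w J)
    (h : filterComb v = filterComb w) : v = w := by
  classical
  funext J
  refine sub_eq_zero.1 (mem_of_forall_sum_le_mem ⊥ (v - w) (fun T => ?_) J)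
  rw [AddSubgroup.mem_bot]
  simp only [Pi.sub_apply, Finset.sum_sub_distrib, sub_eq_zero]
  exact le_antisymm (sum_le_of_filterComb_eq hw hv0 hsum.symm h.symm T)
    (sum_le_of_filterComb_eq hv hw0 hsum h T)

/-- Layer cake decomposition: a monotone function with values in `[0, c]` is a combination of
the characteristic vectors of a chain of order filters, with nonnegative weights of total `c`. -/
theorem exists_chainWeights (f : R → ℝ) (hf : Monotone f) (h0 : 0 ≤ f) (c : ℝ) (hc0 : 0 ≤ c)
    (hc : ∀ p, f p ≤ c) :
    ∃ w : UpperSet R → ℝ, 0 ≤ w ∧ IsChain (· ≤ ·) (Function.support w) ∧ ∑ J, w J = c ∧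
      filterComb w = f := by
  classical
  induction hn : (Finset.univ.filter fun p => f p ≠ 0).card using Nat.strong_induction_on
    generalizing f c with
  | _ n ih =>
    rcases (Finset.univ.filter fun p => f p ≠ 0).eq_empty_or_nonempty with hS | hS
    · -- The empty filter `⊤` carries the whole weight when `f` vanishes.
      refine ⟨Pi.single ⊤ c, ?_, ?_, by simp, ?_⟩
      · exact Pi.single_nonneg.2 hc0
      · exact (Set.subsingleton_singleton.anti Pi.support_single_subset).isChain
      · rw [filterComb_single]
        funext p
        have hp : f p = 0 := by
          by_contra hp
          have : p ∈ Finset.univ.filter fun p => f p ≠ 0 := by simpa using hp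
          simp [hS] at this
        simp [hp, filterVec_of_notMem]
    · -- Peel off the filter `S` on which `f` is nonzero, with the least value of `f` on `S` as
      -- its weight; the remainder `g` vanishes at one more point.
      obtain ⟨q, hq, hmin⟩ := Finset.exists_min_image _ f hS
      have hq : f q ≠ 0 := by simpa using hq
      have hmq : 0 < f q := lt_of_le_of_ne (h0 q) hq.symm
      have hmin : ∀ p, f p ≠ 0 → f q ≤ f p := fun p hp => hmin p (by simpa using hp)
      let S : UpperSet R := ⟨{p | f p ≠ 0}, fun p p' hpp' (hp : f p ≠ 0) =>
        ((lt_of_le_of_ne (h0 p) hp.symm).trans_le (hf hpp')).ne'⟩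
      have hmemS : ∀ p, p ∈ S ↔ f p ≠ 0 := fun p => Iff.rfl
      let g : R → ℝ := f - f q • filterVec S
      have hgS : ∀ p, p ∈ S → g p = f p - f q := fun p hp => by
        simp [g, filterVec_of_mem hp]
      have hgS' : ∀ p, p ∉ S → g p = 0 := fun p hp => by
        have : f p = 0 := by simpa [hmemS] using hp
        simp [g, filterVec_of_notMem hp, this]
      have hg0 : 0 ≤ g := fun p => by
        by_cases hp : p ∈ S
        · rw [hgS p hp]
          exact sub_nonneg.2 (hmin p hp)
        · exact (hgS' p hp).ge
      have hgm : Monotone g := fun p p' hpp' => by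
        by_cases hp : p ∈ S
        · rw [hgS p hp, hgS p' (S.upper hpp' hp)]
          exact sub_le_sub_right (hf hpp') _
        · rw [hgS' p hp]
          exact hg0 p'
      have hgc : ∀ p, g p ≤ c - f q := fun p => by
        by_cases hp : p ∈ S
        · rw [hgS p hp]
          exact sub_le_sub_right (hc p) _
        · rw [hgS' p hp]
          exact sub_nonneg.2 (hc q)
      have hcard : (Finset.univ.filter fun p => g p ≠ 0).card < n := by
        rw [← hn]
        refine Finset.card_lt_card ?_
        rw [Finset.ssubset_iff_of_subset]
        · exact ⟨q, by simpa using hq, by simp [hgS q hq]⟩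
        · intro p hp
          simp only [Finset.mem_filter, Finset.mem_univ, true_and] at hp ⊢
          by_contra hp'
          exact hp (hgS' p (by simpa [hmemS] using hp'))
      obtain ⟨w, hw0, hw, hwc, hwg⟩ := ih _ hcard g hgm hg0 (c - f q) (sub_nonneg.2 (hc q)) hgc rfl
      refine ⟨Pi.single S (f q) + w, ?_, ?_, ?_, ?_⟩
      · exact add_nonneg (Pi.single_nonneg.2 (h0 q)) hw0
      · have hsupp : Function.support (Pi.single S (f q) + w) ⊆ insert S (Function.support w) :=
          (Function.support_add _ _).trans
            (Set.union_subset_union_left _ Pi.support_single_subset)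
        refine IsChain.mono hsupp (hw.insert fun J hJ _ => Or.inl fun p hp => ?_)
        by_contra hpS
        have hp0 : filterComb w p = 0 := by rw [hwg, hgS' p hpS]
        rw [filterComb_apply, Finset.sum_eq_zero_iff_of_nonneg fun K _ => hw0 K] at hp0
        exact hJ (hp0 J (Finset.mem_filter.2 ⟨Finset.mem_univ J, hp⟩))
      · simp [Finset.sum_add_distrib, hwc]
      · rw [filterComb_add, filterComb_single, hwg]
        simp [g]

end ChainWeights

/-! ### Dilates of the order polytope -/

section OrderPolytope

variable {R : Type} [PartialOrder R]

theorem orderPolytope_eq_convexHull_image :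
    orderPolytope R = convexHull ℝ (filterVec '' (Set.univ : Set (UpperSet R))) := by
  rw [Set.image_univ]
  rfl

variable [Fintype R]

/-- The convex hull of the characteristic vectors of a set of order filters. -/
theorem mem_convexHull_image_filterVec {C : Set (UpperSet R)} {x : R → ℝ} :
    x ∈ convexHull ℝ (filterVec '' C) ↔
      ∃ w : UpperSet R → ℝ, 0 ≤ w ∧ Function.support w ⊆ C ∧ ∑ J, w J = 1 ∧ filterComb w = x := by
  classical
  constructor
  · intro hx
    refine convexHull_min (t := {x | ∃ w : UpperSet R → ℝ, 0 ≤ w ∧ Function.support w ⊆ C ∧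
      ∑ J, w J = 1 ∧ filterComb w = x}) ?_ ?_ hx
    · rintro _ ⟨J, hJ, rfl⟩
      refine ⟨Pi.single J 1, Pi.single_nonneg.2 zero_le_one,
        Pi.support_single_subset.trans (Set.singleton_subset_iff.2 hJ), by simp, ?_⟩
      rw [filterComb_single, one_smul]
    · rintro _ ⟨v, hv0, hvC, hv1, rfl⟩ _ ⟨w, hw0, hwC, hw1, rfl⟩ a b ha hb hab
      refine ⟨a • v + b • w, ?_, ?_, ?_, ?_⟩
      · exact add_nonneg (smul_nonneg ha hv0) (smul_nonneg hb hw0)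
      · exact (Function.support_add _ _).trans (Set.union_subset
          ((Function.support_const_smul_subset a v).trans hvC)
          ((Function.support_const_smul_subset b w).trans hwC))
      · simp [Finset.sum_add_distrib, ← Finset.mul_sum, hv1, hw1, hab]
      · simp [filterComb, add_smul, mul_smul, Finset.sum_add_distrib, Finset.smul_sum]
  · rintro ⟨w, hw0, hwC, hw1, rfl⟩
    have hs : ∀ J, J ∉ Finset.univ.filter (fun J => w J ≠ 0) → w J = 0 := fun J hJ => by
      simpa using hJ
    have hsum : ∑ J with w J ≠ 0, w J = 1 := by
      rw [← hw1]
      exact Finset.sum_subset (Finset.subset_univ _) fun J _ hJ => hs J hJ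
    have hcomb : filterComb w = ∑ J with w J ≠ 0, w J • filterVec J := by
      refine (Finset.sum_subset (Finset.subset_univ _) fun J _ hJ => ?_).symm
      rw [hs J hJ, zero_smul]
    rw [hcomb]
    refine (convex_convexHull ℝ _).sum_mem (fun J _ => hw0 J) hsum fun J hJ => ?_
    exact subset_convexHull ℝ _ ⟨J, hwC (by simpa using hJ), rfl⟩

theorem monotone_filterComb {w : UpperSet R → ℝ} (hw : 0 ≤ w) : Monotone (filterComb w) := by
  classical
  intro p q hpq
  rw [filterComb_apply, filterComb_apply]
  refine Finset.sum_le_sum_of_subset_of_nonneg (fun J hJ => ?_) fun J _ _ => hw J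
  simp only [Finset.mem_filter, Finset.mem_univ, true_and] at hJ ⊢
  exact J.upper hpq hJ

theorem mem_orderPolytope_iff {f : R → ℝ} :
    f ∈ orderPolytope R ↔ Monotone f ∧ ∀ p, 0 ≤ f p ∧ f p ≤ 1 := by
  classical
  rw [orderPolytope_eq_convexHull_image, mem_convexHull_image_filterVec]
  constructor
  · rintro ⟨w, hw0, -, hw1, rfl⟩
    refine ⟨monotone_filterComb hw0, fun p => ?_⟩
    rw [filterComb_apply, ← hw1]
    exact ⟨Finset.sum_nonneg fun J _ => hw0 J,
      Finset.sum_le_sum_of_subset_of_nonneg (Finset.filter_subset _ _) fun J _ _ => hw0 J⟩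
  · rintro ⟨hf, hf01⟩
    obtain ⟨w, hw0, -, hw1, hwf⟩ :=
      exists_chainWeights f hf (fun p => (hf01 p).1) 1 zero_le_one fun p => (hf01 p).2
    exact ⟨w, hw0, Set.subset_univ _, hw1, hwf⟩

theorem mem_smul_orderPolytope_iff (k : ℕ) {f : R → ℝ} :
    f ∈ (k : ℝ) • orderPolytope R ↔ Monotone f ∧ ∀ p, 0 ≤ f p ∧ f p ≤ k := by
  have hk : (0 : ℝ) ≤ k := Nat.cast_nonneg k
  constructor
  · rintro ⟨g, hg, rfl⟩
    rw [mem_orderPolytope_iff] at hg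
    refine ⟨fun p q hpq => mul_le_mul_of_nonneg_left (hg.1 hpq) hk, fun p => ⟨?_, ?_⟩⟩
    · exact mul_nonneg hk (hg.2 p).1
    · exact mul_le_of_le_one_right hk (hg.2 p).2
  · rintro ⟨hf, hfk⟩
    rcases k.eq_zero_or_pos with rfl | hpos
    · have hf0 : f = 0 := funext fun p => le_antisymm (by simpa using (hfk p).2) (hfk p).1
      refine ⟨0, mem_orderPolytope_iff.2 ⟨monotone_const, fun p => by simp⟩, by simp [hf0]⟩
    · have hk0 : (0 : ℝ) < k := by exact_mod_cast hpos
      refine (Set.mem_smul_set_iff_inv_smul_mem₀ hk0.ne' _ _).2 (mem_orderPolytope_iff.2 ?_)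
      refine ⟨fun p q hpq => mul_le_mul_of_nonneg_left (hf hpq) (inv_nonneg.2 hk), fun p => ?_⟩
      refine ⟨mul_nonneg (inv_nonneg.2 hk) (hfk p).1, ?_⟩
      change (k : ℝ)⁻¹ * f p ≤ 1
      rw [inv_mul_le_iff₀ hk0, mul_one]
      exact (hfk p).2

theorem mem_latticePoints_smul_iff (k : ℕ) {z : R → ℤ} :
    z ∈ latticePoints ((k : ℝ) • orderPolytope R) ↔ Monotone z ∧ ∀ p, 0 ≤ z p ∧ z p ≤ k := by
  rw [latticePoints, Set.mem_ofPred_eq, mem_smul_orderPolytope_iff]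
  refine and_congr ⟨fun h p q hpq => ?_, fun h p q hpq => ?_⟩
    (forall_congr' fun p => and_congr ?_ ?_)
  · exact Int.cast_le.1 (h hpq)
  · exact Int.cast_le.2 (h hpq)
  · exact Int.cast_nonneg_iff
  · simp only [latticeEmb]
    exact_mod_cast Iff.rfl

theorem latticePoints_orderPolytope :
    latticePoints (orderPolytope R) =
      Set.range fun J : UpperSet R => Set.indicator (J : Set R) (1 : R → ℤ) := by
  ext z
  have h := mem_latticePoints_smul_iff (R := R) 1 (z := z)
  rw [Nat.cast_one, one_smul] at h
  rw [h]
  constructor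
  · rintro ⟨hz, hz01⟩
    refine ⟨⟨{p | 0 < z p}, fun p q hpq (hp : 0 < z p) => hp.trans_le (hz hpq)⟩,
      funext fun p => ?_⟩
    have := hz01 p
    change Set.indicator {p | 0 < z p} 1 p = z p
    by_cases hp : 0 < z p
    · rw [Set.indicator_of_mem (by exact hp), Pi.one_apply]
      lia
    · rw [Set.indicator_of_notMem (by exact hp)]
      lia
  · rintro ⟨J, rfl⟩
    refine ⟨fun p q hpq => ?_, fun p => ?_⟩
    · dsimp only
      by_cases hp : p ∈ (J : Set R)
      · simp [hp, show q ∈ (J : Set R) from J.upper hpq hp]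
      · rw [Set.indicator_of_notMem hp]
        exact Set.indicator_nonneg (fun _ _ => zero_le_one) q
    · by_cases hp : p ∈ (J : Set R) <;> simp [hp]

/-- Truncation at level `k` splits a lattice point of `(k + l)Q` as `min z k + (z - min z k)`. -/
theorem isNormal_orderPolytope : IsNormal (orderPolytope R) := by
  intro k l
  ext z
  rw [Set.mem_add]
  simp only [mem_latticePoints_smul_iff]
  constructor
  · rintro ⟨x, ⟨hx, hxk⟩, y, ⟨hy, hyl⟩, rfl⟩
    refine ⟨hx.add hy, fun p => ?_⟩
    have h1 := hxk p
    have h2 := hyl p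
    simp only [Pi.add_apply, Nat.cast_add]
    lia
  · rintro ⟨hz, hzk⟩
    refine ⟨fun p => min (z p) k, ⟨fun p q hpq => ?_, fun p => ?_⟩,
      fun p => z p - min (z p) k, ⟨fun p q hpq => ?_, fun p => ?_⟩, ?_⟩
    · exact min_le_min_right _ (hz hpq)
    · have := hzk p
      lia
    · have := hz hpq
      change z p - min (z p) k ≤ z q - min (z q) k
      lia
    · have := hzk p
      rw [Nat.cast_add] at this
      lia
    · funext p
      simp

/-- A lattice point of `Q` can be taken away from a lattice point of `(N + 1)Q`, by normality, so
that the semigroup at `m` consists of the `u` such that `u + N m` lies in `NQ` for some `N`. -/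
theorem mem_closure_sub_iff {m u : R → ℤ} :
    u ∈ AddSubmonoid.closure ((fun w => w - m) '' latticePoints (orderPolytope R)) ↔
      ∃ N : ℕ, u + N • m ∈ latticePoints ((N : ℝ) • orderPolytope R) := by
  constructor
  · intro hu
    induction hu using AddSubmonoid.closure_induction with
    | mem u hu =>
      obtain ⟨w, hw, rfl⟩ := hu
      exact ⟨1, by simpa using hw⟩
    | zero =>
      refine ⟨0, (mem_latticePoints_smul_iff 0).2 ⟨?_, by simp⟩⟩
      rw [zero_smul, add_zero]
      exact monotone_const
    | add x y _ _ hx hy =>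
      obtain ⟨M, hM⟩ := hx
      obtain ⟨N, hN⟩ := hy
      refine ⟨M + N, ?_⟩
      rw [← isNormal_orderPolytope M N, add_smul, add_add_add_comm]
      exact Set.add_mem_add hM hN
  · rintro ⟨N, hN⟩
    induction N generalizing u with
    | zero =>
      rw [mem_latticePoints_smul_iff] at hN
      have hu : u = 0 := funext fun p => by simpa using le_antisymm (hN.2 p).2 (hN.2 p).1
      rw [hu]
      exact zero_mem _
    | succ N ih =>
      rw [← isNormal_orderPolytope N 1] at hN
      obtain ⟨x, hx, y, hy, hxy⟩ := hN
      rw [Nat.cast_one, one_smul] at hy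
      have hu : u = (x - N • m) + (y - m) := by
        have : u = (x + y) - (N + 1) • m := eq_sub_of_add_eq hxy.symm
        rw [this, add_smul, one_smul]
        abel
      rw [hu]
      exact add_mem (ih (by simpa using hx)) (AddSubmonoid.subset_closure ⟨y, hy, rfl⟩)

theorem isVeryAmple_orderPolytope : IsVeryAmple (orderPolytope R) := by
  intro m hm n z hn hz
  have hm' : m ∈ latticePoints (orderPolytope R) := hm.1
  rw [mem_closure_sub_iff] at hz ⊢
  obtain ⟨N, hN⟩ := hz
  refine ⟨N, ?_⟩
  have hm1 : m ∈ latticePoints (((1 : ℕ) : ℝ) • orderPolytope R) := by simpa using hm'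
  rw [mem_latticePoints_smul_iff] at hN hm1 ⊢
  have hn' : (1 : ℤ) ≤ n := by exact_mod_cast hn
  -- `n (z + N m)` is the sum of `n z + N m`, which lies in `NQ`, and of `(n - 1) N m`.
  have key : ∀ p, (n : ℤ) * (z p + N * m p) = (n * z p + N * m p) + ((n - 1) * N) * m p := by
    intro p
    ring
  have hc : (0 : ℤ) ≤ (n - 1) * N := mul_nonneg (by lia) (by lia)
  have hval : ∀ p, (z + N • m) p = z p + N * m p := fun p => by simp
  have hval' : ∀ p, (n • z + N • m) p = n * z p + N * m p := fun p => by simp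
  refine ⟨fun p q hpq => ?_, fun p => ⟨?_, ?_⟩⟩
  · have h1 := hN.1 hpq
    have h2 := mul_le_mul_of_nonneg_left (hm1.1 hpq) hc
    rw [hval', hval'] at h1
    rw [hval, hval]
    refine le_of_mul_le_mul_left ?_ (by lia : (0 : ℤ) < n)
    rw [key, key]
    exact add_le_add h1 h2
  · have h1 := (hN.2 p).1
    have h2 := mul_nonneg hc (hm1.2 p).1
    rw [hval'] at h1
    rw [hval]
    refine nonneg_of_mul_nonneg_right ?_ (by lia : (0 : ℤ) < n)
    rw [key]
    exact add_nonneg h1 h2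
  · have h1 := (hN.2 p).2
    have h2 := mul_le_mul_of_nonneg_left (hm1.2 p).2 hc
    rw [hval'] at h1
    rw [hval]
    refine le_of_mul_le_mul_left ?_ (by lia : (0 : ℤ) < n)
    rw [key]
    refine (add_le_add h1 h2).trans_eq ?_
    push_cast
    ring

theorem veryAmpleMultiple_orderPolytope : veryAmpleMultiple (orderPolytope R) = 1 := by
  have h1 : 1 ∈ {k : ℕ | 0 < k ∧ IsVeryAmple ((k : ℝ) • orderPolytope R)} :=
    ⟨one_pos, by simpa using isVeryAmple_orderPolytope⟩
  exact le_antisymm (Nat.sInf_le h1) (Nat.sInf_mem ⟨1, h1⟩).1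

end OrderPolytope

/-! ### The unimodular triangulation by chains of order filters -/

section Triangulation

variable {R : Type} [Fintype R] [PartialOrder R]

theorem filterComb_sum {ι : Type*} (s : Finset ι) (w : ι → UpperSet R → ℝ) :
    filterComb (∑ i ∈ s, w i) = ∑ i ∈ s, filterComb (w i) := by
  simp only [filterComb, Finset.sum_apply, Finset.sum_smul]
  exact Finset.sum_comm

theorem affineIndependent_filterVec {C : Set (UpperSet R)} (hC : IsChain (· ≤ ·) C) :
    AffineIndependent ℝ fun J : C => filterVec (J : UpperSet R) := by
  classical
  rw [affineIndependent_iff]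
  intro s c hc0 hc J hJ
  obtain ⟨w, hwdef⟩ : ∃ w : UpperSet R → ℝ, w = ∑ K ∈ s, Pi.single (K : UpperSet R) (c K) :=
    ⟨_, rfl⟩
  have hw : ∀ K : UpperSet R, w K = ∑ L ∈ s, if K = L then c L else 0 := fun K => by
    simp [hwdef, Finset.sum_apply, Pi.single_apply]
  have hwC : Function.support w ⊆ C := by
    intro K hK
    rw [Function.mem_support, hw] at hK
    obtain ⟨L, -, hL⟩ := Finset.exists_ne_zero_of_sum_ne_zero hK
    by_contra hKC
    exact hL (if_neg fun h : K = L => hKC (h ▸ L.2))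
  have hsum : ∑ K, w K = 0 := by
    rw [Finset.sum_congr rfl fun K _ => hw K, Finset.sum_comm]
    simpa using hc0
  have hcomb : filterComb w = 0 := by
    rw [hwdef, filterComb_sum, ← hc]
    exact Finset.sum_congr rfl fun K _ => filterComb_single _ _
  have h0 := chainWeight_mem ⊥ w (hC.mono hwC) (by simp [hsum]) (by simp [hcomb]) J
  rw [AddSubgroup.mem_bot, hw] at h0
  rw [← h0, Finset.sum_eq_single J]
  · simp
  · intro L _ hLJ
    exact if_neg fun h => hLJ (Subtype.ext h.symm)
  · exact fun h => absurd hJ h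

theorem affineIndependent_image_filterVec {C : Set (UpperSet R)} (hC : IsChain (· ≤ ·) C) :
    AffineIndependent ℝ ((↑) : filterVec '' C → R → ℝ) := by
  have h := (affineIndependent_filterVec hC).range
  have e : Set.range (fun J : C => filterVec (J : UpperSet R)) = filterVec '' C := by
    ext x
    simp
  rwa [e] at h

variable (R) in
/-- The triangulation of the order polytope: its simplices are spanned by the characteristic
vectors of the nonempty chains of order filters. -/
def orderTriangulation : Geometry.SimplicialComplex ℝ (R → ℝ) where
  faces := {s | s.Nonempty ∧ ∃ C : Set (UpperSet R), IsChain (· ≤ ·) C ∧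
    (s : Set (R → ℝ)) = filterVec '' C}
  isRelLowerSet_faces := by
    rintro s ⟨hs, C, hC, hsC⟩
    refine ⟨hs, fun t hts ht => ⟨ht, C ∩ filterVec ⁻¹' t, hC.mono Set.inter_subset_left, ?_⟩⟩
    rw [Set.image_inter_preimage, ← hsC]
    exact (Set.inter_eq_right.2 (Finset.coe_subset.2 hts)).symm
  indep := by
    rintro s ⟨-, C, hC, hsC⟩
    have h := affineIndependent_image_filterVec hC
    rwa [← hsC] at h
  inter_subset_convexHull := by
    rintro s t ⟨-, C, hC, hs⟩ ⟨-, D, hD, ht⟩ x ⟨hxs, hxt⟩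
    rw [hs, mem_convexHull_image_filterVec] at hxs
    rw [ht, mem_convexHull_image_filterVec] at hxt
    obtain ⟨v, hv0, hvC, hv1, rfl⟩ := hxs
    obtain ⟨w, hw0, hwD, hw1, hvw⟩ := hxt
    obtain rfl : w = v := chainWeight_unique (hD.mono hwD) (hC.mono hvC) hw0 hv0
      (hw1.trans hv1.symm) hvw
    rw [hs, ht, ← Set.image_inter filterVec_injective, mem_convexHull_image_filterVec]
    exact ⟨w, hw0, Set.subset_inter hvC hwD, hw1, rfl⟩

theorem finite_faces_orderTriangulation : (orderTriangulation R).faces.Finite := by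
  have h : (Set.range fun C : Set (UpperSet R) => filterVec '' C).Finite := Set.finite_range _
  refine (h.preimage Finset.coe_injective.injOn).subset ?_
  rintro s ⟨-, C, -, hC⟩
  exact ⟨C, hC.symm⟩

theorem space_orderTriangulation : (orderTriangulation R).space = orderPolytope R := by
  classical
  refine Set.Subset.antisymm ?_ fun x hx => ?_
  · refine Set.iUnion₂_subset ?_
    rintro s ⟨-, C, -, hC⟩
    rw [hC, orderPolytope_eq_convexHull_image]
    exact convexHull_mono (Set.image_mono (Set.subset_univ C))
  · rw [mem_orderPolytope_iff] at hx
    obtain ⟨w, hw0, hw, hw1, hwx⟩ :=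
      exists_chainWeights x hx.1 (fun p => (hx.2 p).1) 1 zero_le_one fun p => (hx.2 p).2
    have hfin : (filterVec '' Function.support w).Finite := Set.toFinite _
    have hne : (Function.support w).Nonempty := by
      rw [Function.support_nonempty_iff]
      rintro rfl
      simp at hw1
    rw [Geometry.SimplicialComplex.mem_space_iff]
    refine ⟨hfin.toFinset, ⟨?_, Function.support w, hw, hfin.coe_toFinset⟩, ?_⟩
    · exact hfin.toFinset_nonempty.2 (hne.image _)
    · rw [hfin.coe_toFinset, mem_convexHull_image_filterVec]
      exact ⟨w, hw0, subset_rfl, hw1, hwx⟩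

theorem exists_filterComb_of_mem_span {C : Set (UpperSet R)} {J : UpperSet R} (hJ : J ∈ C)
    {x : R → ℝ} (hx : x ∈ Submodule.span ℝ ((fun v => v - filterVec J) '' (filterVec '' C))) :
    ∃ w : UpperSet R → ℝ, Function.support w ⊆ C ∧ ∑ K, w K = 0 ∧ filterComb w = x := by
  classical
  induction hx using Submodule.span_induction with
  | mem x hx =>
    obtain ⟨_, ⟨K, hK, rfl⟩, rfl⟩ := hx
    refine ⟨Pi.single K 1 + Pi.single J (-1), ?_, ?_, ?_⟩
    · exact (Function.support_add _ _).trans (Set.union_subset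
        (Pi.support_single_subset.trans (Set.singleton_subset_iff.2 hK))
        (Pi.support_single_subset.trans (Set.singleton_subset_iff.2 hJ)))
    · simp [Finset.sum_add_distrib]
    · simp [filterComb_add, filterComb_single, sub_eq_add_neg]
  | zero => exact ⟨0, by simp, by simp, by simp [filterComb]⟩
  | add x y _ _ hx hy =>
    obtain ⟨v, hvC, hv, rfl⟩ := hx
    obtain ⟨w, hwC, hw, rfl⟩ := hy
    exact ⟨v + w, (Function.support_add _ _).trans (Set.union_subset hvC hwC),
      by simp [Finset.sum_add_distrib, hv, hw], filterComb_add v w⟩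
  | smul a x _ hx =>
    obtain ⟨w, hwC, hw, rfl⟩ := hx
    exact ⟨a • w, (Function.support_const_smul_subset a w).trans hwC,
      by simp [← Finset.mul_sum, hw], by simp [filterComb, mul_smul, Finset.smul_sum]⟩

/-- The weights of a lattice vector in the span of the edges of a simplex are integers, because
they are integral combinations of its coordinates. -/
theorem latticeEmb_mem_span_int {C : Set (UpperSet R)} (hC : IsChain (· ≤ ·) C) {J : UpperSet R}
    (hJ : J ∈ C) {z : R → ℤ}
    (hz : latticeEmb z ∈ Submodule.span ℝ ((fun v => v - filterVec J) '' (filterVec '' C))) :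
    latticeEmb z ∈ Submodule.span ℤ ((fun v => v - filterVec J) '' (filterVec '' C)) := by
  obtain ⟨w, hwC, hw0, hwz⟩ := exists_filterComb_of_mem_span hJ hz
  have hint : ∀ K, w K ∈ (Int.castAddHom ℝ).range :=
    chainWeight_mem _ w (hC.mono hwC) (by rw [hw0]; exact zero_mem _) fun p =>
      ⟨z p, by rw [hwz]; rfl⟩
  have hsum : latticeEmb z = ∑ K, w K • (filterVec K - filterVec J) := by
    simp only [smul_sub, Finset.sum_sub_distrib, ← Finset.sum_smul, hw0, zero_smul, sub_zero]
    exact hwz.symm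
  rw [hsum]
  refine Submodule.sum_mem _ fun K _ => ?_
  by_cases hK : w K = 0
  · rw [hK, zero_smul]
    exact zero_mem _
  · obtain ⟨n, hn⟩ := hint K
    rw [← hn, Int.coe_castAddHom, Int.cast_smul_eq_zsmul]
    exact Submodule.smul_mem _ _ (Submodule.subset_span ⟨_, ⟨K, hwC hK, rfl⟩, rfl⟩)

theorem hasUnimodularTriangulation_orderPolytope :
    HasUnimodularTriangulation (orderPolytope R) := by
  refine ⟨orderTriangulation R, finite_faces_orderTriangulation, space_orderTriangulation, ?_⟩
  rintro s ⟨-, C, hC, hs⟩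
  rw [hs]
  refine ⟨fun v hv => ?_, fun v hv z hz => ?_⟩
  · rw [← Finset.mem_coe, hs] at hv
    obtain ⟨J, -, rfl⟩ := hv
    exact filterVec_mem_range_latticeEmb J
  · rw [← Finset.mem_coe, hs] at hv
    obtain ⟨J, hJ, rfl⟩ := hv
    exact latticeEmb_mem_span_int hC hJ hz

end Triangulation

/-! ### `Proj` of a surjection of graded rings -/

section ProjSurjective

variable {A B σ τ : Type} [CommRing A] [SetLike σ A] [AddSubgroupClass σ A]
  [CommRing B] [SetLike τ B] [AddSubgroupClass τ B]
  {𝒜 : ℕ → σ} {ℬ : ℕ → τ} [GradedRing 𝒜] [GradedRing ℬ]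

/-- A surjective homomorphism of graded rings is surjective in each degree. -/
theorem exists_mem_of_surjective {f : 𝒜 →+*ᵍ ℬ} (hf : Function.Surjective f) {d : ℕ} {b : B}
    (hb : b ∈ ℬ d) : ∃ a ∈ 𝒜 d, f a = b := by
  classical
  obtain ⟨a, rfl⟩ := hf b
  refine ⟨DirectSum.decompose 𝒜 a d, SetLike.coe_mem _, ?_⟩
  rw [f.map_directSumDecompose, DirectSum.decompose_of_mem_same ℬ hb]

theorem irrelevant_le_map_of_surjective {f : 𝒜 →+*ᵍ ℬ} (hf : Function.Surjective f) :
    HomogeneousIdeal.irrelevant ℬ ≤ (HomogeneousIdeal.irrelevant 𝒜).map f := by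
  rw [HomogeneousIdeal.irrelevant_le]
  intro i hi b hb
  obtain ⟨a, ha, rfl⟩ := exists_mem_of_surjective hf hb
  exact Ideal.mem_map_of_mem f (HomogeneousIdeal.mem_irrelevant_of_mem 𝒜 hi ha)

theorem awayMap_surjective {f : 𝒜 →+*ᵍ ℬ} (hf : Function.Surjective f) {d : ℕ} {s : A}
    (hs : s ∈ 𝒜 d) :
    Function.Surjective (HomogeneousLocalization.Away.map f s) := by
  intro y
  obtain ⟨n, b, hb, rfl⟩ := HomogeneousLocalization.Away.mk_surjective ℬ (f.map_mem hs) y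
  obtain ⟨a, ha, rfl⟩ := exists_mem_of_surjective hf hb
  exact ⟨HomogeneousLocalization.Away.mk 𝒜 hs n a ha,
    HomogeneousLocalization.Away.map_mk f s hs n a ha⟩

/-- Over the basic open set of `s`, the morphism is the spectrum of the surjection
`(A_s)₀ → (B_{f s})₀`. -/
theorem isClosedImmersion_projMap {f : 𝒜 →+*ᵍ ℬ} (hf : Function.Surjective f) :
    IsClosedImmersion (Proj.map f (irrelevant_le_map_of_surjective hf)) := by
  have happ : ∀ {d : ℕ} (_ : 0 < d) {s : A} (_ : s ∈ 𝒜 d) (V : (Proj 𝒜).Opens),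
      V = Proj.basicOpen 𝒜 s →
      Function.Surjective ((Proj.map f (irrelevant_le_map_of_surjective hf)).app V) := by
    rintro d hd s hs V rfl
    have hsq := Proj.awayToSection_comp_appLE f (irrelevant_le_map_of_surjective hf) hs
    have hB : Function.Surjective (Proj.awayToSection ℬ (f s)) := by
      rw [← Proj.basicOpenIsoAway_hom ℬ (f s) (f.map_mem hs) hd]
      exact (ConcreteCategory.bijective_of_isIso _).2
    have hcomp := hB.comp (awayMap_surjective hf hs)
    intro y
    obtain ⟨x, hx⟩ := hcomp y
    refine ⟨Proj.awayToSection 𝒜 s x, ?_⟩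
    have hsq' := ConcreteCategory.congr_hom hsq x
    rw [Scheme.Hom.app_eq_appLE]
    exact hsq'.trans hx
  refine (IsZariskiLocalAtTarget.iff_of_iSup_eq_top (P := @IsClosedImmersion)
    (fun s : Σ i : PNat, 𝒜 i => Proj.basicOpen 𝒜 (s.2 : A)) ?_).2 fun s => ?_
  · refine Proj.iSup_basicOpen_eq_top 𝒜 _ ?_
    rw [HomogeneousIdeal.toIdeal_irrelevant_le]
    exact fun i hi x hx => Ideal.subset_span ⟨⟨⟨i, hi⟩, ⟨x, hx⟩⟩, rfl⟩
  · have h1 : IsAffine (Proj.basicOpen 𝒜 (s.2 : A)).toScheme :=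
      Proj.isAffineOpen_basicOpen 𝒜 _ s.2.2 s.1.2
    have h2 : IsAffine ((Proj.map f (irrelevant_le_map_of_surjective hf)) ⁻¹ᵁ
        Proj.basicOpen 𝒜 (s.2 : A)).toScheme :=
      Proj.isAffineOpen_basicOpen ℬ _ (f.map_mem s.2.2) s.1.2
    refine IsClosedImmersion.of_surjective_of_isAffine _ ?_
    rw [morphismRestrict_appTop]
    exact (ConcreteCategory.bijective_of_isIso ((Proj ℬ).presheaf.map
      (eqToHom (image_morphismRestrict_preimage _ _ _)).op)).2.comp
      (happ s.1.2 s.2.2 _ (Scheme.Opens.ι_image_top _))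

/-- The image of `Proj ℬ` in `Proj 𝒜` is the zero locus of the kernel. -/
theorem range_projMap {f : 𝒜 →+*ᵍ ℬ} (hf : Function.Surjective f) :
    Set.range (Proj.map f (irrelevant_le_map_of_surjective hf)) =
      ProjectiveSpectrum.zeroLocus 𝒜 (RingHom.ker f) := by
  ext p
  constructor
  · rintro ⟨q, rfl⟩ a ha
    change f a ∈ q.asHomogeneousIdeal
    rw [(RingHom.mem_ker).1 ha]
    exact zero_mem _
  · intro hp
    have hp' : RingHom.ker f ≤ p.asHomogeneousIdeal.toIdeal := hp
    have hcomap : (p.asHomogeneousIdeal.map f).comap f = p.asHomogeneousIdeal := by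
      apply HomogeneousIdeal.toIdeal_injective
      change (p.asHomogeneousIdeal.toIdeal.map f).comap f = _
      rw [Ideal.comap_map_of_surjective' f hf, sup_eq_left]
      exact hp'
    have := p.isPrime
    let q : ProjectiveSpectrum ℬ :=
      { asHomogeneousIdeal := p.asHomogeneousIdeal.map f
        isPrime := Ideal.map_isPrime_of_surjective hf hp'
        not_irrelevant_le := fun h => p.not_irrelevant_le <| by
          rw [← hcomap, HomogeneousIdeal.irrelevant_le]
          exact fun i hi a ha =>
            h (HomogeneousIdeal.mem_irrelevant_of_mem ℬ hi (f.map_mem ha)) }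
    exact ⟨q, ProjectiveSpectrum.ext hcomap⟩

instance isReduced_proj [IsDomain B] : IsReduced (Proj ℬ) := by
  have hstalk : ∀ x : Proj ℬ, _root_.IsReduced ((Proj ℬ).presheaf.stalk x) := by
    intro x
    have := x.isPrime
    have hx : x.asHomogeneousIdeal.toIdeal.primeCompl ≤ nonZeroDivisors B :=
      Ideal.primeCompl_le_nonZeroDivisors _
    have : IsDomain (Localization x.asHomogeneousIdeal.toIdeal.primeCompl) :=
      IsLocalization.isDomain_localization hx
    have : _root_.IsReduced (HomogeneousLocalization.AtPrime ℬ x.asHomogeneousIdeal.toIdeal) :=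
      isReduced_of_injective (algebraMap _ (Localization x.asHomogeneousIdeal.toIdeal.primeCompl))
        (HomogeneousLocalization.val_injective _)
    exact isReduced_of_injective (Proj.stalkIso ℬ x).hom.hom
      (ConcreteCategory.bijective_of_isIso (Proj.stalkIso ℬ x).hom).1
  exact isReduced_of_isReduced_stalk _

end ProjSurjective

/-! ### Reduced closed subschemes -/

section ReducedClosed

/-- A closed immersion of a reduced scheme identifies it with the reduced induced subscheme on
its image. -/
theorem exists_iso_subscheme_vanishingIdeal {X Y : Scheme.{0}} (i : X ⟶ Y) [IsClosedImmersion i]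
    [IsReduced X] (Z : TopologicalSpace.Closeds Y) (hZ : Set.range i = Z) :
    ∃ e : X ≅ (Scheme.IdealSheafData.vanishingIdeal Z).subscheme,
      e.hom ≫ (Scheme.IdealSheafData.vanishingIdeal Z).subschemeι = i := by
  have hker : i.ker = Scheme.IdealSheafData.vanishingIdeal Z := by
    have hsupp : i.ker.support = Z := by
      apply TopologicalSpace.Closeds.ext
      rw [Scheme.Hom.support_ker, hZ, Z.isClosed.closure_eq]
    rw [← hsupp, Scheme.IdealSheafData.vanishingIdeal_support]
    ext U : 2
    rw [Scheme.IdealSheafData.radical_ideal, Scheme.Hom.ker_apply]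
    exact (Ideal.isRadical_bot.comap (f := (i.app U).hom)).radical.symm
  have h : (Scheme.IdealSheafData.vanishingIdeal Z).subschemeι.ker = i.ker := by
    rw [Scheme.IdealSheafData.ker_subschemeι, hker]
  have := IsClosedImmersion.isIso_lift _ i h
  exact ⟨asIso (IsClosedImmersion.lift _ i h.le), IsClosedImmersion.lift_fac _ i h.le⟩

end ReducedClosed

/-! ### Compatibility with the structure morphisms over the complex numbers -/

section OverC

variable {A B : Type} [CommRing A] [Algebra ℂ A] [CommRing B] [Algebra ℂ B]
  {𝒜 : ℕ → Submodule ℂ A} {ℬ : ℕ → Submodule ℂ B} [GradedAlgebra 𝒜] [GradedAlgebra ℬ]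

theorem awayι_comp_projMap_comp_projOverC_hom (φ : A →ₐ[ℂ] B) {f : 𝒜 →+*ᵍ ℬ}
    (hfφ : ∀ a, f a = φ a)
    (hf : HomogeneousIdeal.irrelevant ℬ ≤ (HomogeneousIdeal.irrelevant 𝒜).map f)
    {d : ℕ} (hd : 0 < d) {s : A} (hs : s ∈ 𝒜 d) :
    Proj.awayι ℬ (f s) (f.map_mem hs) hd ≫ Proj.map f hf ≫ (projOverC 𝒜).hom =
      Proj.awayι ℬ (f s) (f.map_mem hs) hd ≫ (projOverC ℬ).hom := by
  simp only [projOverC, Over.mk_hom]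
  rw [Proj.awayι_comp_map_assoc f hf hd s hs, Proj.awayι_toSpecZero_assoc,
    Proj.awayι_toSpecZero_assoc, ← Spec.map_comp, ← Spec.map_comp,
    ← Spec.map_comp, ← CommRingCat.ofHom_comp, ← CommRingCat.ofHom_comp, ← CommRingCat.ofHom_comp]
  congr 2
  refine RingHom.ext fun c => ?_
  have hle : Submonoid.powers s ≤ (Submonoid.powers (f s)).comap f :=
    Submonoid.powers_le.2 (Submonoid.mem_powers (f s))
  change HomogeneousLocalization.map f hle (HomogeneousLocalization.mk _) =
    HomogeneousLocalization.mk _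
  rw [HomogeneousLocalization.map_mk]
  refine HomogeneousLocalization.val_injective _ ?_
  rw [HomogeneousLocalization.val_mk, HomogeneousLocalization.val_mk]
  congr 1
  · change f (algebraMap ℂ A c) = algebraMap ℂ B c
    rw [hfφ, φ.commutes]
  · exact Subtype.ext (map_one f)

theorem projMap_comp_projOverC_hom (φ : A →ₐ[ℂ] B) {f : 𝒜 →+*ᵍ ℬ} (hfφ : ∀ a, f a = φ a)
    (hf : HomogeneousIdeal.irrelevant ℬ ≤ (HomogeneousIdeal.irrelevant 𝒜).map f) :
    Proj.map f hf ≫ (projOverC 𝒜).hom = (projOverC ℬ).hom :=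
  (Proj.mapAffineOpenCover f hf).openCover.hom_ext _ _ fun s =>
    awayι_comp_projMap_comp_projOverC_hom φ hfφ hf s.1.2 s.2.2

end OverC

/-! ### The Hibi variety as the closure of a torus orbit -/

section HibiToric

attribute [local instance] MvPolynomial.gradedAlgebra

variable (P : Type) [Fintype P] [PartialOrder P]

theorem latticePoints_orderPolytope_dual :
    latticePoints (orderPolytope Pᵒᵈ) = Set.range fun I : LowerSet P =>
      Set.indicator (OrderDual.ofDual ⁻¹' (I : Set P)) (1 : Pᵒᵈ → ℤ) := by
  rw [latticePoints_orderPolytope]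
  ext z
  constructor
  · rintro ⟨J, rfl⟩
    exact ⟨⟨OrderDual.toDual ⁻¹' (J : Set Pᵒᵈ), fun p q hqp hp => J.upper hqp hp⟩, rfl⟩
  · rintro ⟨I, rfl⟩
    exact ⟨⟨OrderDual.ofDual ⁻¹' (I : Set P), fun p q hpq hp => I.lower hpq hp⟩, rfl⟩

/-- The order polytope is very ample, so that no proper multiple of it is taken. -/
theorem polytopeToricVariety_orderPolytope :
    polytopeToricVariety (orderPolytope Pᵒᵈ) = toricVariety (latticePoints (orderPolytope Pᵒᵈ)) := by
  rw [polytopeToricVariety, veryAmpleMultiple_orderPolytope, Nat.cast_one, one_smul]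

theorem bijective_idealPoint :
    Function.Bijective fun I : LowerSet P =>
      (⟨Set.indicator (OrderDual.ofDual ⁻¹' (I : Set P)) 1,
        (latticePoints_orderPolytope_dual P).ge ⟨I, rfl⟩⟩ : latticePoints (orderPolytope Pᵒᵈ)) := by
  constructor
  · intro I J h
    have h' := Set.indicator_one_inj ℤ (congrArg Subtype.val h)
    exact SetLike.coe_injective h'
  · rintro ⟨z, hz⟩
    obtain ⟨I, rfl⟩ := (latticePoints_orderPolytope_dual P).le hz
    exact ⟨I, rfl⟩

/-- The order ideals of `P` correspond to the lattice points of the order polytope. -/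
def idealEquiv : LowerSet P ≃ latticePoints (orderPolytope Pᵒᵈ) :=
  Equiv.ofBijective _ (bijective_idealPoint P)

/-- The presentation of the Hibi ring, with variables indexed by the lattice points of the order
polytope. -/
def latticePresentation : MvPolynomial (latticePoints (orderPolytope Pᵒᵈ)) ℂ →ₐ[ℂ] hibiRing P :=
  (hibiPresentation P).comp (rename (idealEquiv P).symm)

theorem latticePresentation_surjective : Function.Surjective (latticePresentation P) :=
  (hibiPresentation_surjective P).comp (rename_surjective _ (idealEquiv P).symm.surjective)

theorem latticePresentation_X (I : LowerSet P) :
    (latticePresentation P (X (idealEquiv P I)) : MvPolynomial (Option P) ℂ) =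
      hibiMonomial P I := by
  simp [latticePresentation, hibiPresentation]

/-- The presentation of the Hibi ring as a homomorphism of graded rings. -/
def gradedPresentation :
    homogeneousSubmodule (latticePoints (orderPolytope Pᵒᵈ)) ℂ →+*ᵍ hibiGrading P where
  toRingHom := (latticePresentation P).toRingHom
  map_mem {_ f} hf := ⟨rename (idealEquiv P).symm f, IsHomogeneous.rename_isHomogeneous hf, rfl⟩

theorem gradedPresentation_surjective : Function.Surjective (gradedPresentation P) :=
  latticePresentation_surjective P

variable {P}

/-- The point of the affine space of `ℂ[x_p, t]` with coordinates `x_p = u_p` and `t = c`. -/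
def coordPoint (u : Pᵒᵈ → ℂˣ) (c : ℂ) : Option P → ℂ
  | none => c
  | some p => u (OrderDual.toDual p)

theorem eval_hibiMonomial (u : Pᵒᵈ → ℂˣ) (c : ℂ) (I : LowerSet P) :
    eval (coordPoint u c) (hibiMonomial P I) =
      c * monomialMap (latticePoints (orderPolytope Pᵒᵈ)) u (idealEquiv P I) := by
  classical
  have hI : ((idealEquiv P I : latticePoints (orderPolytope Pᵒᵈ)) : Pᵒᵈ → ℤ) =
    Set.indicator (OrderDual.ofDual ⁻¹' (I : Set P)) 1 := rfl
  rw [hibiMonomial, map_mul, map_prod, eval_X, monomialMap, hI, Units.coe_prod]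
  simp only [eval_X, coordPoint]
  congr 1
  rw [Finset.prod_filter]
  refine Fintype.prod_equiv OrderDual.toDual _ _ fun p => ?_
  by_cases hp : p ∈ I
  · have hp' : OrderDual.toDual p ∈ OrderDual.ofDual ⁻¹' (I : Set P) := hp
    rw [Set.indicator_of_mem hp', if_pos hp]
    simp
  · have hp' : OrderDual.toDual p ∉ OrderDual.ofDual ⁻¹' (I : Set P) := hp
    rw [Set.indicator_of_notMem hp', if_neg hp]
    simp

theorem eval_latticePresentation (u : Pᵒᵈ → ℂˣ) (c : ℂ)
    (g : MvPolynomial (latticePoints (orderPolytope Pᵒᵈ)) ℂ) :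
    eval (coordPoint u c) (latticePresentation P g : MvPolynomial (Option P) ℂ) =
      eval (c • monomialMap (latticePoints (orderPolytope Pᵒᵈ)) u) g := by
  have h : (aeval (coordPoint u c)).comp ((hibiRing P).val.comp (latticePresentation P)) =
      aeval (c • monomialMap (latticePoints (orderPolytope Pᵒᵈ)) u) := by
    ext a
    obtain ⟨I, rfl⟩ := (idealEquiv P).surjective a
    rw [AlgHom.comp_apply, AlgHom.comp_apply, Subalgebra.val_apply, latticePresentation_X,
      aeval_X]
    exact eval_hibiMonomial u c I
  exact DFunLike.congr_fun h g

/-- The kernel of the presentation is the ideal of all polynomials that vanish at the points of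
the torus orbit. -/
theorem latticePresentation_eq_zero_iff
    (g : MvPolynomial (latticePoints (orderPolytope Pᵒᵈ)) ℂ) :
    latticePresentation P g = 0 ↔
      ∀ u, g ∈ lineIdeal (monomialMap (latticePoints (orderPolytope Pᵒᵈ)) u) := by
  simp only [mem_lineIdeal, ← eval_latticePresentation]
  constructor
  · intro h u c
    rw [h]
    simp
  · intro h
    -- A polynomial over an infinite field that vanishes where all `x_p` are nonzero is zero.
    refine Subtype.ext (MvPolynomial.funext_set (R := ℂ)
      (fun o => Option.casesOn o Set.univ fun _ => {0}ᶜ) ?_ ?_)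
    · rintro (_ | p)
      · exact Set.infinite_univ
      · exact (Set.finite_singleton 0).infinite_compl
    · intro x hx
      have hx0 : ∀ p, x (some p) ≠ 0 := fun p => hx (some p) (Set.mem_univ _)
      have hxc : coordPoint (fun p => Units.mk0 _ (hx0 (OrderDual.ofDual p))) (x none) = x := by
        funext o
        cases o <;> rfl
      have := h (fun p => Units.mk0 _ (hx0 (OrderDual.ofDual p))) (x none)
      rw [hxc] at this
      rw [this]
      simp

theorem monomialMap_ne_zero (u : Pᵒᵈ → ℂˣ) :
    monomialMap (latticePoints (orderPolytope Pᵒᵈ)) u ≠ 0 :=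
  fun h => Units.ne_zero _ (congrFun h (idealEquiv P ⊥))

variable (P) in
theorem range_projMap_gradedPresentation :
    Set.range (Proj.map (gradedPresentation P)
      (irrelevant_le_map_of_surjective (gradedPresentation_surjective P))) =
      closure (torusImage (latticePoints (orderPolytope Pᵒᵈ))) := by
  rw [range_projMap (gradedPresentation_surjective P)]
  refine Eq.trans ?_ (ProjectiveSpectrum.zeroLocus_vanishingIdeal_eq_closure _ _)
  congr 1
  ext g
  refine (latticePresentation_eq_zero_iff g).trans ?_
  refine Iff.trans ?_ (ProjectiveSpectrum.mem_vanishingIdeal _ g).symm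
  constructor
  · rintro h _ ⟨u, hu, rfl⟩
    exact h u
  · exact fun h u => h _ ⟨u, monomialMap_ne_zero u, rfl⟩

variable (P) in
theorem nonempty_iso_polytopeToricVariety :
    Nonempty (hibiVariety P ≅ polytopeToricVariety (orderPolytope Pᵒᵈ)) := by
  rw [polytopeToricVariety_orderPolytope]
  have := isClosedImmersion_projMap (gradedPresentation_surjective P)
  obtain ⟨e, he⟩ := exists_iso_subscheme_vanishingIdeal
    (Proj.map (gradedPresentation P)
      (irrelevant_le_map_of_surjective (gradedPresentation_surjective P)))
    ⟨closure (torusImage (latticePoints (orderPolytope Pᵒᵈ))), isClosed_closure⟩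
    (range_projMap_gradedPresentation P)
  refine ⟨Over.isoMk e ?_⟩
  have hcomp := projMap_comp_projOverC_hom (latticePresentation P) (f := gradedPresentation P)
    (fun _ => rfl) (irrelevant_le_map_of_surjective (gradedPresentation_surjective P))
  rw [← he] at hcomp
  exact (Category.assoc _ _ _).symm.trans hcomp

end HibiToric

end

end HibiVariety

theorem proposition2p1 (P : Type) [Fintype P] [PartialOrder P] :
    Nonempty (HibiVariety.hibiVariety P ≅
        HibiVariety.polytopeToricVariety (HibiVariety.orderPolytope Pᵒᵈ)) ∧
      HibiVariety.latticePoints (HibiVariety.orderPolytope Pᵒᵈ) =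
        Set.range (fun I : LowerSet P =>
          Set.indicator (OrderDual.ofDual ⁻¹' (I : Set P)) (1 : Pᵒᵈ → ℤ)) ∧
      HibiVariety.HasUnimodularTriangulation (HibiVariety.orderPolytope Pᵒᵈ) ∧
      HibiVariety.IsNormal (HibiVariety.orderPolytope Pᵒᵈ) :=
  ⟨HibiVariety.nonempty_iso_polytopeToricVariety P,
    HibiVariety.latticePoints_orderPolytope_dual P,
    HibiVariety.hasUnimodularTriangulation_orderPolytope, HibiVariety.isNormal_orderPolytope⟩
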